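/- Let $\mathcal M$ be a commutative von Neumann algebra on a complex Hilbert space $H$, equipped with a faithful normal semifinite trace $\tau$. Let $S(\tau)$ be the $*$-algebra of $\tau$-measurable operators, i.e. of the closed densely defined operators $x$ on $H$ that are affiliated with $\mathcal M$ and satisfy $\tau(e^{|x|}(\lambda,\infty))<\infty$ for some $\lambda>0$ (where $e^{|x|}$ is the spectral measure of $|x|$), with the strong sum and strong product. Call $x\in S(\tau)$ *$\tau$-compact* if $\lim_{t\to\infty}\mu(t;x)=0$, where $\mu(t;x)=\inf\{s\ge 0:\tau(e^{|x|}(s,\infty))\le t\}$. Let $\mathbb E$ be a Banach $\mathcal M$-bimodule of $\tau$-compact operators, i.e. a linear subspace of $S(\tau)$ consisting of $\tau$-compact operators, with a complete norm $\|\cdot\|_{\mathbb E}$ such that $uxv\in\mathbb E$ and $\|uxv\|_{\mathbb E}\le\|u\|\,\|v\|\,\|x\|_{\mathbb E}$ for all $x\in\mathbb E$ and $u,v\in\mathcal M$. Then every derivation $\delta:\mathcal M\to\mathbb E$, i.e. every linear map with $\delta(ab)=\delta(a)b+a\delta(b)$ for all $a,b\in\mathcal M$, is zero. In particular, let $S(0,1)$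 be the algebra of all (classes of) complex Lebesgue measurable functions on $(0,1)$, and let $\mathbb E\subseteq S(0,1)$ be a linear subspace with a complete norm such that $uxv\in\mathbb E$ and $\|uxv\|_{\mathbb E}\le\|u\|_\infty\|v\|_\infty\|x\|_{\mathbb E}$ for all $x\in\mathbb E$ and $u,v\in L_\infty(0,1)$. If $\delta:L_\infty(0,1)\to S(0,1)$ is a linear map with $\delta(fg)=\delta(f)g+f\delta(g)$ for all $f,g\in L_\infty(0,1)$, and $\delta(L_\infty(0,1))\subseteq\mathbb E$, then $\delta=0$. -/

import Mathlib

open MeasureTheory Filter Topology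
open scoped NNReal ENNReal

noncomputable section

namespace TauCompact

universe u

section Operators

variable {H : Type u} [NormedAddCommGroup H] [InnerProductSpace ℂ H] [CompleteSpace H]

/-- A faithful normal semifinite trace on the von Neumann algebra `M`: a `[0,∞]`-valued function on
the positive cone of `M`. (Only the values at positive elements of `M` are meaningful: no condition
speaks about other values, and no definition below uses them.) -/
structure FNSTrace (M : VonNeumannAlgebra H) where
  /-- the underlying function -/
  toFun : (H →L[ℂ] H) → ℝ≥0∞
  map_add : ∀ a ∈ M, ∀ b ∈ M, 0 ≤ a → 0 ≤ b → toFun (a + b) = toFun a + toFun b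
  map_smul : ∀ (c : ℝ≥0), ∀ a ∈ M, 0 ≤ a → toFun (((c : ℝ) : ℂ) • a) = c * toFun a
  tracial : ∀ a ∈ M, toFun (star a * a) = toFun (a * star a)
  faithful : ∀ a ∈ M, 0 ≤ a → toFun a = 0 → a = 0
  normal : ∀ S : Set (H →L[ℂ] H), S.Nonempty → (∀ a ∈ S, a ∈ M ∧ 0 ≤ a) → DirectedOn (· ≤ ·) S →
    ∀ a ∈ M, IsLUB S a → toFun a = ⨆ b ∈ S, toFun b
  semifinite : ∀ a ∈ M, 0 ≤ a → a ≠ 0 → ∃ b ∈ M, 0 ≤ b ∧ b ≤ a ∧ b ≠ 0 ∧ toFun b < ∞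

/-- The (not necessarily bounded, partially defined) operator `x` is affiliated with `M`: for every
`y` in the commutant of `M` one has `y x ⊆ x y`. -/
def Affiliated (M : VonNeumannAlgebra H) (x : H →ₗ.[ℂ] H) : Prop :=
  ∀ y ∈ M.commutant, ∀ ξ : x.domain, ∃ h : y (ξ : H) ∈ x.domain, x ⟨y (ξ : H), h⟩ = y (x ξ)

/-- The closure of the graph of `x`, as a closed subspace of the Hilbert sum `H ⊕ H`. For a closed
operator it is the graph itself. -/
abbrev graphL2 (x : H →ₗ.[ℂ] H) : Submodule ℂ (WithLp 2 (H × H)) :=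
  (x.graph.map (WithLp.linearEquiv 2 ℂ (H × H)).symm.toLinearMap).topologicalClosure

/-- For a closed densely defined operator `x` this is the bounded operator `(1 + x* x)⁻¹`: the
upper left corner of the orthogonal projection of `H ⊕ H` onto the graph of `x`. In fact
`(h, 0) = (f, x f) + (-x* g, g)` says `g = -x f` and `h = f + x* x f`;
see `modulusResolvent_spec` below. -/
def modulusResolvent (x : H →ₗ.[ℂ] H) : H →L[ℂ] H :=
  WithLp.fstL 2 ℂ H H ∘L (graphL2 x).starProjection ∘L
    (WithLp.prodContinuousLinearEquiv 2 ℂ H H).symm.toContinuousLinearMap ∘L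
    ContinuousLinearMap.inl ℂ H H

/-- For closed densely defined `x`, the spectral projection `e^{|x|}(s, ∞)`, `s ≥ 0`. As
`|x| > s` if and only if `(1 + |x|²)⁻¹ < (1 + s²)⁻¹`, this is the spectral projection of
`(1 + x* x)⁻¹` for the interval `(-∞, (1 + s²)⁻¹)`, that is the range projection of the positive
part of `(1 + s²)⁻¹ - (1 + x* x)⁻¹`. -/
def spectralProj (x : H →ₗ.[ℂ] H) (s : ℝ≥0) : H →L[ℂ] H :=
  (cfc (fun r : ℝ => max ((1 + (s : ℝ) ^ 2)⁻¹ - r) 0)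
    (modulusResolvent x)).range.topologicalClosure.starProjection

variable {M : VonNeumannAlgebra H}

/-- `x ∈ S(τ)`: the operator `x` is `τ`-measurable. -/
structure TauMeasurable (τ : FNSTrace M) (x : H →ₗ.[ℂ] H) : Prop where
  isClosed : x.IsClosed
  dense_domain : Dense (x.domain : Set H)
  affiliated : Affiliated M x
  exists_finite : ∃ s : ℝ≥0, 0 < s ∧ τ.toFun (spectralProj x s) < ∞

/-- The generalized singular value function
`μ(t; x) = inf {s ≥ 0 : τ(e^{|x|}(s, ∞)) ≤ t}` (with `inf ∅ = ∞`). -/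
def singularValue (τ : FNSTrace M) (x : H →ₗ.[ℂ] H) (t : ℝ≥0) : ℝ≥0∞ :=
  ⨅ (s : ℝ≥0) (_ : τ.toFun (spectralProj x s) ≤ t), (s : ℝ≥0∞)

/-- `x ∈ S₀(τ)`: the operator `x` is `τ`-compact. -/
def TauCompactOp (τ : FNSTrace M) (x : H →ₗ.[ℂ] H) : Prop :=
  TauMeasurable τ x ∧ Tendsto (fun t : ℝ≥0 => singularValue τ x t) atTop (𝓝 0)

/-- A bounded operator as an (everywhere defined) element of `H →ₗ.[ℂ] H`. -/
def ofBounded (a : H →L[ℂ] H) : H →ₗ.[ℂ] H := a.toLinearMap.toPMap ⊤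

/-- The strong sum: the closure of the algebraic sum. -/
def strongAdd (x y : H →ₗ.[ℂ] H) : H →ₗ.[ℂ] H := (x + y).closure

/-- The strong scalar multiple: the closure of the algebraic one (which matters only for the
scalar `0`). -/
def strongSMul (c : ℂ) (x : H →ₗ.[ℂ] H) : H →ₗ.[ℂ] H := (c • x).closure

/-- The algebraic product `x y`, with domain `{ξ ∈ D(y) : y ξ ∈ D(x)}`. -/
def algMul (x y : H →ₗ.[ℂ] H) : H →ₗ.[ℂ] H :=
  x.comp (y.domRestrict ((x.domain.comap y.toFun).map y.domain.subtype)) (by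
    rintro ⟨ξ, ⟨η, hη, rfl⟩, h⟩
    exact hη)

/-- The strong product: the closure of the algebraic product. -/
def strongMul (x y : H →ₗ.[ℂ] H) : H →ₗ.[ℂ] H := (algMul x y).closure

/-- The set `E`, with the Banach space structure carried by the instances, is a Banach
`M`-bimodule of `τ`-measurable operators: a linear subspace of `S(τ)` (for the strong operations)
with a complete norm such that `u x v ∈ E` and `‖u x v‖_E ≤ ‖u‖ ‖v‖ ‖x‖_E` for `u, v ∈ M` and
`x ∈ E`. -/
structure IsBanachBimodule (τ : FNSTrace M) (E : Set (H →ₗ.[ℂ] H))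
    [NormedAddCommGroup E] [NormedSpace ℂ E] [CompleteSpace E] : Prop where
  tauMeasurable : ∀ x ∈ E, TauMeasurable τ x
  coe_add : ∀ x y : E, ((x + y : E) : H →ₗ.[ℂ] H) = strongAdd x y
  coe_smul : ∀ (c : ℂ) (x : E), ((c • x : E) : H →ₗ.[ℂ] H) = strongSMul c x
  exists_mul : ∀ u ∈ M, ∀ v ∈ M, ∀ x : E,
    ∃ h : strongMul (strongMul (ofBounded u) x) (ofBounded v) ∈ E,
      ‖(⟨_, h⟩ : E)‖ ≤ ‖u‖ * ‖v‖ * ‖x‖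

/-- The linear map `δ : M → E` is a derivation: `δ(ab) = δ(a) b + a δ(b)`, with the operations
of `S(τ)`. -/
def IsDerivation {E : Set (H →ₗ.[ℂ] H)} [NormedAddCommGroup E] [NormedSpace ℂ E]
    (δ : M.toStarSubalgebra →ₗ[ℂ] E) : Prop :=
  ∀ a b : M.toStarSubalgebra, ((δ (a * b) : E) : H →ₗ.[ℂ] H) =
    strongAdd (strongMul (δ a : E) (ofBounded (b : H →L[ℂ] H)))
      (strongMul (ofBounded (a : H →L[ℂ] H)) (δ b : E))

/-- For closed `x`, the vector `f = modulusResolvent x h` is in `D(x)` and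
`⟨f, g⟩ + ⟨x f, x g⟩ = ⟨h, g⟩` for all `g ∈ D(x)`, that is `(1 + x* x) f = h`. -/
theorem modulusResolvent_spec {x : H →ₗ.[ℂ] H} (hx : x.IsClosed) (h : H) :
    ∃ hf : modulusResolvent x h ∈ x.domain, ∀ g : x.domain,
      inner ℂ (modulusResolvent x h) (g : H) + inner ℂ (x ⟨modulusResolvent x h, hf⟩) (x g) =
        inner ℂ h (g : H) := by
  have hG : graphL2 x = x.graph.map (WithLp.linearEquiv 2 ℂ (H × H)).symm.toLinearMap := by
    apply IsClosed.submodule_topologicalClosure_eq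
    have h1 : ((x.graph.map (WithLp.linearEquiv 2 ℂ (H × H)).symm.toLinearMap :
        Submodule ℂ (WithLp 2 (H × H))) : Set (WithLp 2 (H × H))) =
        (WithLp.prodContinuousLinearEquiv 2 ℂ H H) ⁻¹' (x.graph : Set (H × H)) := by
      ext z
      constructor
      · rintro ⟨w, hw, rfl⟩
        exact hw
      · intro hz
        exact ⟨_, hz, rfl⟩
    rw [h1]
    exact IsClosed.preimage (WithLp.prodContinuousLinearEquiv 2 ℂ H H).continuous hx
  have hP := (graphL2 x).starProjection_apply_mem (WithLp.toLp 2 (h, (0 : H)))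
  have hO := (graphL2 x).starProjection_inner_eq_zero (WithLp.toLp 2 (h, (0 : H)))
  have hR : modulusResolvent x h =
      ((graphL2 x).starProjection (WithLp.toLp 2 (h, (0 : H)))).fst := rfl
  generalize (graphL2 x).starProjection (WithLp.toLp 2 (h, (0 : H))) = p at hP hO hR
  rw [hR]
  rw [hG] at hP
  obtain ⟨⟨f, k⟩, hw, rfl⟩ := hP
  obtain ⟨y, hy1, hy2⟩ := (LinearPMap.mem_graph_iff _).1 hw
  simp only at hy1 hy2
  subst hy1 hy2
  refine ⟨y.2, fun g => ?_⟩
  have h2 := hO (WithLp.toLp 2 ((g : H), x g)) (by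
    rw [hG]
    exact ⟨((g : H), x g), x.mem_graph g, rfl⟩)
  rw [WithLp.prod_inner_apply] at h2
  simp [inner_sub_left] at h2 ⊢
  linear_combination -h2

end Operators

section Functions

/-- Lebesgue measure on `(0,1)`. -/
abbrev unitMeasure : Measure ℝ := volume.restrict (Set.Ioo 0 1)

/-- `S(0,1)`: classes of complex measurable functions on `(0,1)`. -/
abbrev S01 : Type := ℝ →ₘ[unitMeasure] ℂ

/-- `L_∞(0,1)`, a subspace of `S(0,1)`. -/
abbrev Linf01 : Type := Lp ℂ ∞ unitMeasure

/-- The pointwise product on `L_∞(0,1)`. -/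
def linfMul (f g : Linf01) : Linf01 :=
  ⟨(f : S01) * (g : S01), by
    rw [Lp.mem_Lp_iff_memLp]
    exact (memLp_congr_ae (AEEqFun.coeFn_mul _ _)).2 (MemLp.mul (Lp.memLp g) (Lp.memLp f))⟩

/-- The set `E`, with the Banach space structure carried by the instances, is a Banach
`L_∞(0,1)`-bimodule in `S(0,1)`. -/
structure IsBanachFunctionBimodule (E : Set S01)
    [NormedAddCommGroup E] [NormedSpace ℂ E] [CompleteSpace E] : Prop where
  coe_add : ∀ x y : E, ((x + y : E) : S01) = (x : S01) + (y : S01)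
  coe_smul : ∀ (c : ℂ) (x : E), ((c • x : E) : S01) = c • (x : S01)
  exists_mul : ∀ (u v : Linf01) (x : E),
    ∃ h : (u : S01) * (x : S01) * (v : S01) ∈ E, ‖(⟨_, h⟩ : E)‖ ≤ ‖u‖ * ‖v‖ * ‖x‖

/-- The linear map `δ : L_∞(0,1) → S(0,1)` is a derivation. -/
def IsFunctionDerivation (δ : Linf01 →ₗ[ℂ] S01) : Prop :=
  ∀ f g : Linf01, δ (linfMul f g) = δ f * (g : S01) + (f : S01) * δ g

end Functions

end TauCompact

end

/-! Both claims reduce to one fact: for a compact metric space K, a derivation D from C(K) to a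
Banach C(K)-module vanishes (`derivation_continuousMap_eq_zero`). The functions annihilating the
range of D form a closed ideal I, hence all functions vanishing on some closed set S. On I the
derivation is zero, since I is spanned by squares of its elements and D(r²) = 2r·Dr. S is finite by
a gliding hump: were it infinite, disjoint bumps φₙ centred in S and unitaries uₙ would yield F = Σ
2⁻ⁿ uₙ^{kₙ} φₙ with ‖DF‖ > n for every n, because D(u^k) = k u^{k-1} Du has norm growing like k. No
continuity of D is assumed. For finite S, a polynomial p with simple roots at the values f(S) gives
p(f) ∈ I, so p(f)·Df = 0 and p'(f)·Df = D(p(f)) = 0, and coprimality of p and p' forces Df = 0. To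
apply this to an element a of M, take K to be the spectrum of a and pull δ back along the continuous
functional calculus; for functions, compose with a bounded representative of f. In the operator case
one must check that strong sums and products satisfy the module axioms. This is done on the range of
an injective self-adjoint element of M, which determines a measurable operator. -/

noncomputable section

namespace TauCompact

/-! ### Derivations of C(K) into Banach modules. -/

section ContinuousFunctions

variable {K : Type*} [MetricSpace K] [CompactSpace K]
  {E : Type*} [NormedAddCommGroup E] [NormedSpace ℂ E] [Module C(K, ℂ) E]

/-- The functions that annihilate the range of the derivation `D`. -/
def annihilatorIdeal (D : Derivation ℂ C(K, ℂ) E) : Ideal C(K, ℂ) where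
  carrier := {f | ∀ g, f • D g = 0}
  add_mem' hf hg h := by rw [add_smul, hf h, hg h, add_zero]
  zero_mem' h := zero_smul _ _
  smul_mem' c f hf h := by rw [smul_eq_mul, mul_smul, hf h, smul_zero]

theorem isClosed_annihilatorIdeal (hE : ∀ (f : C(K, ℂ)) (x : E), ‖f • x‖ ≤ ‖f‖ * ‖x‖)
    (D : Derivation ℂ C(K, ℂ) E) : IsClosed (annihilatorIdeal D : Set C(K, ℂ)) := by
  have h : (annihilatorIdeal D : Set C(K, ℂ)) = ⋂ g, {f | f • D g = 0} := by
    ext f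
    simp [annihilatorIdeal]
  rw [h]
  refine isClosed_iInter fun g => isClosed_eq ?_ continuous_const
  exact AddMonoidHomClass.continuous_of_bound
    ((LinearMap.toSpanSingleton C(K, ℂ) E (D g)).toAddMonoidHom) ‖D g‖
    fun f => (hE f (D g)).trans_eq (mul_comm _ _)

/-- A closed ideal of C(K) is determined by its set of common zeros. -/
theorem mem_annihilatorIdeal_iff (hE : ∀ (f : C(K, ℂ)) (x : E), ‖f • x‖ ≤ ‖f‖ * ‖x‖)
    (D : Derivation ℂ C(K, ℂ) E) (f : C(K, ℂ)) : f ∈ annihilatorIdeal D ↔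
      ∀ s ∉ ContinuousMap.setOfIdeal (annihilatorIdeal D), f s = 0 := by
  conv_lhs => rw [← ContinuousMap.idealOfSet_ofIdeal_isClosed (isClosed_annihilatorIdeal hE D)]
  rw [ContinuousMap.mem_idealOfSet]
  rfl

theorem derivation_eq_zero_of_mem_annihilatorIdeal
    (hE : ∀ (f : C(K, ℂ)) (x : E), ‖f • x‖ ≤ ‖f‖ * ‖x‖) (D : Derivation ℂ C(K, ℂ) E)
    {f : C(K, ℂ)} (hf : f ∈ annihilatorIdeal D) : D f = 0 := by
  rw [mem_annihilatorIdeal_iff hE] at hf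
  -- Since √ is 0 on negative reals, u = ±re, ±im gives square roots of the positive and negative
  -- parts of Re f and Im f. They vanish wherever f does, so they stay in the ideal.
  let r (u : ℂ → ℝ) (hu : Continuous u) : C(K, ℂ) := ⟨fun s => ((√(u (f s)) : ℝ) : ℂ), by fun_prop⟩
  have hr (u : ℂ → ℝ) (hu : Continuous u) (h0 : u 0 = 0) : D (r u hu * r u hu) = 0 := by
    have : r u hu ∈ annihilatorIdeal D := by
      rw [mem_annihilatorIdeal_iff hE]
      intro s hs
      simp [r, hf s hs, h0]
    rw [D.leibniz, this, add_zero]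
  have key (t : ℝ) : ((√t : ℝ) : ℂ) * (√t : ℝ) - (√(-t) : ℝ) * (√(-t) : ℝ) = t := by
    norm_cast
    rcases le_total 0 t with h | h
    · rw [Real.mul_self_sqrt h, Real.sqrt_eq_zero_of_nonpos (by linarith)]; simp
    · rw [Real.mul_self_sqrt (neg_nonneg.2 h), Real.sqrt_eq_zero_of_nonpos h]; simp
  let a := r (fun z => z.re) (by fun_prop)
  let b := r (fun z => -z.re) (by fun_prop)
  let c := r (fun z => z.im) (by fun_prop)
  let d := r (fun z => -z.im) (by fun_prop)
  have hfe : f = (a * a - b * b) + Complex.I • (c * c - d * d) := by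
    ext s
    change f s = (((√((f s).re) : ℝ) : ℂ) * (√((f s).re) : ℝ) -
      (√(-(f s).re) : ℝ) * (√(-(f s).re) : ℝ)) + Complex.I * (((√((f s).im) : ℝ) : ℂ) *
      (√((f s).im) : ℝ) - (√(-(f s).im) : ℝ) * (√(-(f s).im) : ℝ))
    rw [key, key, mul_comm, Complex.re_add_im]
  have ha : D (a * a) = 0 := hr (fun z => z.re) (by fun_prop) (by simp)
  have hb : D (b * b) = 0 := hr (fun z => -z.re) (by fun_prop) (by simp)
  have hc : D (c * c) = 0 := hr (fun z => z.im) (by fun_prop) (by simp)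
  have hd : D (d * d) = 0 := hr (fun z => -z.im) (by fun_prop) (by simp)
  rw [hfe, D.map_add, D.map_smul, D.map_sub, D.map_sub, ha, hb, hc, hd]
  simp

theorem derivation_eq_zero_of_finite (hE : ∀ (f : C(K, ℂ)) (x : E), ‖f • x‖ ≤ ‖f‖ * ‖x‖)
    (D : Derivation ℂ C(K, ℂ) E)
    (hS : (ContinuousMap.setOfIdeal (annihilatorIdeal D))ᶜ.Finite) (f : C(K, ℂ)) : D f = 0 := by
  let T := (hS.image f).toFinset
  let p : Polynomial ℂ := ∏ z ∈ T, (Polynomial.X - Polynomial.C z)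
  have hsep : p.Separable :=
    Polynomial.separable_prod_X_sub_C_iff'.2 fun x _ y _ h => h
  have hp : Polynomial.aeval f p ∈ annihilatorIdeal D := by
    rw [mem_annihilatorIdeal_iff hE]
    intro s hs
    have h1 : (Polynomial.aeval f p) s = Polynomial.aeval (f s) p :=
      (Polynomial.aeval_algHom_apply (ContinuousMap.evalAlgHom ℂ ℂ s) f p).symm
    rw [h1, Polynomial.coe_aeval_eq_eval, Polynomial.eval_prod]
    exact Finset.prod_eq_zero (i := f s) (by simpa [T] using ⟨s, hs, rfl⟩) (by simp)
  obtain ⟨u, v, huv⟩ := hsep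
  have h0 := derivation_eq_zero_of_mem_annihilatorIdeal hE D hp
  rw [D.map_aeval] at h0
  have h1 := congrArg (fun q => Polynomial.aeval f q • D f) huv
  simp only [map_add, map_mul, add_smul, mul_smul, map_one, one_smul] at h1
  rw [h0, hp f, smul_zero, smul_zero, add_zero] at h1
  exact h1.symm

/-- Unitaries span C(K). They are wanted because their powers keep norm 1 while D(u^k) grows
linearly in k. -/
theorem exists_unitary_smul_derivation_ne_zero (D : Derivation ℂ C(K, ℂ) E) {f g : C(K, ℂ)}
    (h : f • D g ≠ 0) [IsScalarTower ℂ C(K, ℂ) E] : ∃ u ∈ unitary C(K, ℂ), f • D u ≠ 0 := by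
  by_contra! hc
  apply h
  clear h
  have hg : g ∈ Submodule.span ℂ (unitary C(K, ℂ) : Set C(K, ℂ)) := by
    rw [CStarAlgebra.span_unitary]; trivial
  induction hg using Submodule.span_induction with
  | mem u hu => exact hc u hu
  | zero => simp
  | add x y _ _ hx hy => rw [D.map_add, smul_add, hx, hy, add_zero]
  | smul c x _ hx => rw [D.map_smul, smul_comm, hx, smul_zero]

/-- Expand D(φf) in two ways by the Leibniz rule, using the hypothesis for the second. The term ε k
u^{k-1} φ²·Du keeps its norm when the unitary factor is removed, and every other term is bounded
independently of k. -/
theorem norm_smul_derivation_le (hE : ∀ (f : C(K, ℂ)) (x : E), ‖f • x‖ ≤ ‖f‖ * ‖x‖)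
    [IsScalarTower ℂ C(K, ℂ) E] [Nonempty K] (D : Derivation ℂ C(K, ℂ) E) {φ f u : C(K, ℂ)}
    (hφ : ‖φ‖ ≤ 1) (hu : u ∈ unitary C(K, ℂ)) {ε : ℝ} (h0 : 0 ≤ ε) (h1 : ε ≤ 1) (k : ℕ)
    (h : φ * f = (ε : ℂ) • (u ^ k * (φ * φ))) :
    ε * k * ‖(φ * φ) • D u‖ ≤ ‖D f‖ + ‖f‖ * ‖D φ‖ + ‖D (φ * φ)‖ := by
  have hn (v : C(K, ℂ)) (hv : v ∈ unitary C(K, ℂ)) (x : E) : ‖v • x‖ ≤ ‖x‖ := by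
    simpa [CStarRing.norm_of_mem_unitary hv] using hE v x
  have hk : k * ‖(φ * φ) • D u‖ ≤ ‖(φ * φ) • D (u ^ k)‖ := by
    have h2 : star (u ^ (k - 1)) • ((φ * φ) • D (u ^ k)) = (k : ℝ) • (φ * φ) • D u := by
      rw [D.leibniz_pow, ← Nat.cast_smul_eq_nsmul ℝ, smul_comm (φ * φ) (k : ℝ), smul_comm _ (k : ℝ),
        smul_comm (φ * φ), ← mul_smul, Unitary.star_mul_self_of_mem (pow_mem hu _), one_smul]
    calc k * ‖(φ * φ) • D u‖ = ‖(k : ℝ) • (φ * φ) • D u‖ := by simp [norm_smul]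
      _ ≤ _ := by rw [← h2]; exact hn _ (Unitary.star_mem (pow_mem hu _)) _
  have h3 : (ε : ℂ) • (φ * φ) • D (u ^ k) =
      φ • D f + f • D φ - (ε : ℂ) • u ^ k • D (φ * φ) := by
    rw [← D.leibniz, h, D.map_smul, D.leibniz (u ^ k), smul_add]
    abel
  have h4 : ‖(ε : ℂ)‖ = ε := by simp [abs_of_nonneg h0]
  calc ε * k * ‖(φ * φ) • D u‖ ≤ ε * ‖(φ * φ) • D (u ^ k)‖ := by
        rw [mul_assoc]; gcongr
    _ = ‖φ • D f + f • D φ - (ε : ℂ) • u ^ k • D (φ * φ)‖ := by rw [← h3, norm_smul (ε : ℂ), h4]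
    _ ≤ ‖φ • D f‖ + ‖f • D φ‖ + ‖(ε : ℂ) • u ^ k • D (φ * φ)‖ :=
        (norm_sub_le _ _).trans (by gcongr; exact norm_add_le _ _)
    _ ≤ 1 * ‖D f‖ + ‖f‖ * ‖D φ‖ + 1 * ‖D (φ * φ)‖ := by
        gcongr
        · exact (hE _ _).trans (by gcongr)
        · exact hE _ _
        · rw [norm_smul (ε : ℂ), h4]
          gcongr
          exact hn _ (pow_mem hu _) _
    _ = _ := by ring

/-- An infinite set contains a sequence sₙ that is discrete in the subspace topology. With rₙ at
most the distance from sₙ to the other points, the balls of radius rₙ/2 are disjoint, and tent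
functions on them are the bumps. -/
theorem exists_bumps {S : Set K} (hS : S.Infinite) : ∃ (s : ℕ → K) (φ : ℕ → C(K, ℂ)),
    (∀ n, s n ∈ S ∧ φ n (s n) = 1 ∧ ‖φ n‖ ≤ 1) ∧ Pairwise fun m n => φ m * φ n = 0 := by
  have := hS.to_subtype
  obtain ⟨t, ht⟩ := exists_topology_isEmbedding_nat S
  let s (n : ℕ) : K := t n
  have hs : IsEmbedding s := IsEmbedding.subtypeVal.comp ht
  have hr (n : ℕ) : ∃ r > 0, ∀ m, m ≠ n → r ≤ dist (s m) (s n) := by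
    have h1 : {n} ∈ 𝓝 n := mem_nhds_discrete.2 rfl
    rw [hs.nhds_eq_comap, (Metric.nhds_basis_ball.comap s).mem_iff] at h1
    obtain ⟨r, hr, h⟩ := h1
    exact ⟨r, hr, fun m hm => not_lt.1 fun hlt => hm (h (show s m ∈ Metric.ball _ _ from hlt))⟩
  choose r hr0 hr using hr
  refine ⟨s, fun n => ⟨fun x => ((max 0 (1 - 2 * dist x (s n) / r n) : ℝ) : ℂ), by fun_prop⟩,
    fun n => ⟨(t n).2, by simp, ?_⟩, fun m n hmn => ?_⟩
  · refine (ContinuousMap.norm_le _ zero_le_one).2 fun x => ?_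
    have h1 : 0 ≤ 2 * dist x (s n) / r n := by have := hr0 n; positivity
    simp only [ContinuousMap.coe_mk, Complex.norm_real, Real.norm_eq_abs]
    rw [abs_of_nonneg (le_max_left _ _)]
    exact max_le zero_le_one (by linarith)
  · ext x
    simp only [ContinuousMap.mul_apply, ContinuousMap.coe_mk, ContinuousMap.zero_apply]
    rw [mul_eq_zero, Complex.ofReal_eq_zero, Complex.ofReal_eq_zero, max_eq_left_iff,
      max_eq_left_iff, sub_nonpos, sub_nonpos, le_div_iff₀ (hr0 m), le_div_iff₀ (hr0 n)]
    by_contra! h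
    have h1 := hr n m hmn
    have h2 := hr m n hmn.symm
    rw [dist_comm] at h2
    have h3 := dist_triangle_left (s m) (s n) x
    linarith [h.1, h.2]

theorem finite_compl_setOfIdeal_annihilatorIdeal
    (hE : ∀ (f : C(K, ℂ)) (x : E), ‖f • x‖ ≤ ‖f‖ * ‖x‖) [IsScalarTower ℂ C(K, ℂ) E]
    (D : Derivation ℂ C(K, ℂ) E) : (ContinuousMap.setOfIdeal (annihilatorIdeal D))ᶜ.Finite := by
  by_contra hS
  obtain ⟨s, φ, h, hd⟩ := exists_bumps hS
  have : Nonempty K := ⟨s 0⟩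
  have hu (n : ℕ) : ∃ u ∈ unitary C(K, ℂ), (φ n * φ n) • D u ≠ 0 := by
    have h1 : φ n * φ n ∉ annihilatorIdeal D := fun hm => by
      have := (mem_annihilatorIdeal_iff hE D _).1 hm (s n) (h n).1
      simp [(h n).2.1] at this
    obtain ⟨g, hg⟩ := not_forall.1 h1
    exact exists_unitary_smul_derivation_ne_zero D hg
  choose u hu hu0 using hu
  -- The constant 2 anticipates ‖F‖ ≤ Σ 2⁻ⁿ = 2 for the sum F below. The exponents are chosen before
  -- F is formed.
  have hk (n : ℕ) : ∃ k : ℕ, n + (2 * ‖D (φ n)‖ + ‖D (φ n * φ n)‖) <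
      (1 / 2 : ℝ) ^ n * k * ‖(φ n * φ n) • D (u n)‖ := by
    have h1 : 0 < (1 / 2 : ℝ) ^ n * ‖(φ n * φ n) • D (u n)‖ := by
      have := norm_pos_iff.2 (hu0 n); positivity
    obtain ⟨k, hk⟩ := Archimedean.arch (n + (2 * ‖D (φ n)‖ + ‖D (φ n * φ n)‖) + 1) h1
    refine ⟨k, ?_⟩
    rw [nsmul_eq_mul] at hk
    linarith
  choose k hk using hk
  let F (n : ℕ) : C(K, ℂ) := (((1 / 2 : ℝ) ^ n : ℝ) : ℂ) • (u n ^ k n * φ n)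
  have hF (n : ℕ) : ‖F n‖ ≤ (1 / 2 : ℝ) ^ n := by
    rw [norm_smul, Complex.norm_real, Real.norm_of_nonneg (by positivity)]
    refine mul_le_of_le_one_right (by positivity) ((norm_mul_le _ _).trans ?_)
    rw [CStarRing.norm_of_mem_unitary (pow_mem (hu n) _), one_mul]
    exact (h n).2.2
  have hsum : Summable F := Summable.of_norm_bounded summable_geometric_two hF
  have hnorm : ‖∑' n, F n‖ ≤ 2 :=
    (tsum_of_norm_bounded hasSum_geometric_two hF)
  -- Multiplying by φₙ isolates the n-th summand, by disjointness of the bumps.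
  have hφ (n : ℕ) : φ n * ∑' m, F m = (((1 / 2 : ℝ) ^ n : ℝ) : ℂ) • (u n ^ k n * (φ n * φ n)) := by
    rw [← hsum.tsum_mul_left, tsum_eq_single n]
    · simp only [F, mul_smul_comm]
      congr 1
      ring
    · intro m hm
      simp only [F, mul_smul_comm]
      rw [mul_left_comm, hd hm.symm, mul_zero, smul_zero]
  obtain ⟨n, hn⟩ := exists_nat_ge ‖D (∑' n, F n)‖
  have h2 := norm_smul_derivation_le hE D (h n).2.2 (hu n) (by positivity)
    (pow_le_one₀ (by norm_num) (by norm_num)) (k n) (hφ n)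
  have h3 : ‖∑' n, F n‖ * ‖D (φ n)‖ ≤ 2 * ‖D (φ n)‖ := by gcongr
  linarith [hk n]

/-- Every derivation from `C(K)` to a Banach `C(K)`-module is zero. -/
theorem derivation_continuousMap_eq_zero (hE : ∀ (f : C(K, ℂ)) (x : E), ‖f • x‖ ≤ ‖f‖ * ‖x‖)
    [IsScalarTower ℂ C(K, ℂ) E] (D : Derivation ℂ C(K, ℂ) E) (f : C(K, ℂ)) : D f = 0 :=
  derivation_eq_zero_of_finite hE D (finite_compl_setOfIdeal_annihilatorIdeal hE D) f

/-- Form of the result used in both applications, where the module structure is an explicit action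
rather than an instance. -/
theorem eq_zero_of_action {K : Type*} [MetricSpace K] [CompactSpace K]
    {E : Type*} [NormedAddCommGroup E] [NormedSpace ℂ E] (act : C(K, ℂ) → E → E)
    (act_add : ∀ f x y, act f (x + y) = act f x + act f y)
    (add_act : ∀ f g x, act (f + g) x = act f x + act g x)
    (mul_act : ∀ f g x, act (f * g) x = act f (act g x))
    (smul_one_act : ∀ (c : ℂ) x, act (c • 1) x = c • x)
    (norm_act : ∀ f x, ‖act f x‖ ≤ ‖f‖ * ‖x‖) (d : C(K, ℂ) →ₗ[ℂ] E)
    (d_mul : ∀ f g, d (f * g) = act f (d g) + act g (d f)) (f : C(K, ℂ)) : d f = 0 := by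
  have act_one (x : E) : act 1 x = x := by simpa using smul_one_act 1 x
  let _ : Module C(K, ℂ) E :=
    { smul := act
      one_smul := act_one
      mul_smul := mul_act
      smul_zero := fun f => map_zero (AddMonoidHom.mk' (act f) (act_add f))
      smul_add := act_add
      add_smul := add_act
      zero_smul := fun x => by
        have := smul_one_act 0 x
        rwa [zero_smul, zero_smul] at this }
  have : IsScalarTower ℂ C(K, ℂ) E := ⟨fun c f x => by
    change act (c • f) x = c • act f x
    rw [← smul_one_act c (act f x), ← mul_act, smul_mul_assoc, one_mul]⟩
  exact derivation_continuousMap_eq_zero norm_act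
    { d with
      map_one_eq_zero' := by
        have h := d_mul 1 1
        rw [mul_one, act_one] at h
        exact left_eq_add.1 h
      leibniz' := d_mul } f

end ContinuousFunctions

-- Closed affiliated operators and their restrictions to ranges of regularizers.

universe u

/-- Let q be the component of w ∈ G orthogonal to T(G). Then q ∈ G, so T(Tq) ∈ T(G) and ‖Tq‖² = ⟨q,
T(Tq)⟩ = 0, whence q = 0. -/
theorem le_topologicalClosure_map_of_isSymmetric {V : Type*} [NormedAddCommGroup V]
    [InnerProductSpace ℂ V] [CompleteSpace V] {T : V →ₗ[ℂ] V} (hT : T.IsSymmetric)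
    (hi : Function.Injective T) {G : Submodule ℂ V} (hG : IsClosed (G : Set V))
    (hTG : G.map T ≤ G) : G ≤ (G.map T).topologicalClosure := by
  intro w hw
  set W := (G.map T).topologicalClosure with hW
  have : CompleteSpace W := (Submodule.isClosed_topologicalClosure _).completeSpace_coe
  have hq : w - W.starProjection w ∈ G :=
    sub_mem hw (Submodule.topologicalClosure_minimal _ hTG hG (W.starProjection_apply_mem w))
  have h0 := W.starProjection_inner_eq_zero w _ (Submodule.le_topologicalClosure _
    (Submodule.mem_map_of_mem (f := T) (hTG (Submodule.mem_map_of_mem hq))))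
  rw [← hT, inner_self_eq_zero, map_eq_zero_iff T hi, sub_eq_zero] at h0
  rw [h0]
  exact W.starProjection_apply_mem w

set_option linter.unusedSectionVars false

section Operators

variable {H : Type u} [NormedAddCommGroup H] [InnerProductSpace ℂ H] [CompleteSpace H]

theorem graphL2_eq {x : H →ₗ.[ℂ] H} (hx : x.IsClosed) :
    graphL2 x = x.graph.map (WithLp.linearEquiv 2 ℂ (H × H)).symm.toLinearMap := by
  apply IsClosed.submodule_topologicalClosure_eq
  have h : ((x.graph.map (WithLp.linearEquiv 2 ℂ (H × H)).symm.toLinearMap :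
      Submodule ℂ (WithLp 2 (H × H))) : Set (WithLp 2 (H × H))) =
      (WithLp.prodContinuousLinearEquiv 2 ℂ H H) ⁻¹' (x.graph : Set (H × H)) := by
    ext z
    exact ⟨fun ⟨w, hw, hz⟩ => hz ▸ hw, fun hz => ⟨_, hz, rfl⟩⟩
  rw [h]
  exact IsClosed.preimage (WithLp.prodContinuousLinearEquiv 2 ℂ H H).continuous hx

theorem toLp_mem_graphL2_iff {x : H →ₗ.[ℂ] H} (hx : x.IsClosed) (ξ η : H) :
    WithLp.toLp 2 (ξ, η) ∈ graphL2 x ↔ (ξ, η) ∈ x.graph := by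
  rw [graphL2_eq hx]
  exact ⟨fun ⟨w, hw, hz⟩ => (WithLp.toLp_injective 2 hz) ▸ hw, fun h => ⟨_, h, rfl⟩⟩

/-- Closed operators commuting with an injective self-adjoint `g` are determined by their
restriction to the range of `g` (one inclusion). -/
theorem le_of_graph_map_le {x y : H →ₗ.[ℂ] H} (hx : x.IsClosed) (hy : y.IsClosed) {g : H →L[ℂ] H}
    (hg : IsSelfAdjoint g) (hi : Function.Injective g)
    (hgx : ∀ ξ η, (ξ, η) ∈ x.graph → (g ξ, g η) ∈ x.graph)
    (hgy : ∀ ξ η, (ξ, η) ∈ x.graph → (g ξ, g η) ∈ y.graph) : x ≤ y := by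
  let e := WithLp.linearEquiv 2 ℂ (H × H)
  let T : WithLp 2 (H × H) →ₗ[ℂ] WithLp 2 (H × H) :=
    e.symm.toLinearMap ∘ₗ ((g : H →ₗ[ℂ] H).prodMap (g : H →ₗ[ℂ] H)) ∘ₗ e.toLinearMap
  have hs := (ContinuousLinearMap.isSelfAdjoint_iff_isSymmetric.1 hg)
  have hT : T.IsSymmetric := fun a b => by
    rw [WithLp.prod_inner_apply, WithLp.prod_inner_apply]
    exact congrArg₂ (· + ·) (hs _ _) (hs _ _)
  have hTi : Function.Injective T :=
    e.symm.injective.comp ((hi.prodMap hi).comp e.injective)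
  have hG {z : H →ₗ.[ℂ] H} (hz : z.IsClosed)
      (h : ∀ ξ η, (ξ, η) ∈ x.graph → (g ξ, g η) ∈ z.graph) : (graphL2 x).map T ≤ graphL2 z := by
    rintro _ ⟨w, hw, rfl⟩
    exact (toLp_mem_graphL2_iff hz _ _).2 (h w.fst w.snd ((toLp_mem_graphL2_iff hx _ _).1 hw))
  have h1 := (le_topologicalClosure_map_of_isSymmetric hT hTi
    (Submodule.isClosed_topologicalClosure _) (hG hx hgx)).trans
    (Submodule.topologicalClosure_minimal _ (hG hy hgy) (Submodule.isClosed_topologicalClosure _))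
  refine LinearPMap.le_graph_iff.1 fun ⟨ξ, η⟩ hw => ?_
  exact (toLp_mem_graphL2_iff hy _ _).1 (h1 ((toLp_mem_graphL2_iff hx _ _).2 hw))

/-- Uniqueness in the weak equation (1 + x*x) f = h: test the difference of two solutions against
itself. -/
theorem eq_modulusResolvent {x : H →ₗ.[ℂ] H} (hx : x.IsClosed) {h f k : H}
    (hf : (f, k) ∈ x.graph)
    (hfk : ∀ ξ η, (ξ, η) ∈ x.graph → inner ℂ f ξ + inner ℂ k η = inner ℂ h ξ) :
    f = modulusResolvent x h := by
  obtain ⟨hr, hs⟩ := modulusResolvent_spec hx h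
  have hd := sub_mem hf (x.mem_graph ⟨_, hr⟩)
  obtain ⟨z, hz1, hz2⟩ := (LinearPMap.mem_graph_iff _).1 hd
  have h1 := hfk _ _ hd
  have h2 := hs z
  simp only [hz1, hz2, Prod.fst_sub, Prod.snd_sub] at h1 h2
  have h3 : inner ℂ (f - modulusResolvent x h) (f - modulusResolvent x h) +
      inner ℂ (k - x ⟨_, hr⟩) (k - x ⟨_, hr⟩) = 0 := by
    rw [inner_sub_left, inner_sub_left (k : H)]
    linear_combination h1 - h2
  have h4 := congrArg Complex.re h3
  rw [Complex.add_re, Complex.zero_re] at h4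
  have h5 := inner_self_nonneg (𝕜 := ℂ) (x := f - modulusResolvent x h)
  have h6 := inner_self_nonneg (𝕜 := ℂ) (x := k - x ⟨_, hr⟩)
  simp only [RCLike.re_to_complex] at h5 h6
  have h7 : RCLike.re (inner ℂ (f - modulusResolvent x h) (f - modulusResolvent x h)) = 0 := by
    simp only [RCLike.re_to_complex]; linarith
  rw [inner_self_eq_norm_sq, sq_eq_zero_iff, norm_eq_zero, sub_eq_zero] at h7
  exact h7

theorem isSelfAdjoint_modulusResolvent {x : H →ₗ.[ℂ] H} (hx : x.IsClosed) :
    IsSelfAdjoint (modulusResolvent x) := by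
  rw [ContinuousLinearMap.isSelfAdjoint_iff_isSymmetric]
  intro h k
  obtain ⟨h1, h2⟩ := modulusResolvent_spec hx h
  obtain ⟨k1, k2⟩ := modulusResolvent_spec hx k
  have h3 := congrArg (starRingEnd ℂ) (k2 ⟨_, h1⟩)
  simp only [map_add, inner_conj_symm] at h3
  exact h3.symm.trans (h2 ⟨_, k1⟩)

theorem injective_modulusResolvent {x : H →ₗ.[ℂ] H} (hx : x.IsClosed)
    (hd : Dense (x.domain : Set H)) : Function.Injective (modulusResolvent x) := by
  refine (injective_iff_map_eq_zero _).2 fun h h0 => ?_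
  obtain ⟨h1, h2⟩ := modulusResolvent_spec hx h
  have h3 : x ⟨modulusResolvent x h, h1⟩ = 0 := by
    rw [← x.map_zero]; congr 1; exact Subtype.ext h0
  refine hd.eq_zero_of_inner_left ℂ fun g hg => ?_
  have h4 := h2 ⟨g, hg⟩
  rw [h3, h0] at h4
  simpa using h4.symm

variable {M : VonNeumannAlgebra H}

theorem Affiliated.mem_graph {x : H →ₗ.[ℂ] H} (hx : Affiliated M x) {y : H →L[ℂ] H}
    (hy : y ∈ M.commutant) {ξ η : H} (h : (ξ, η) ∈ x.graph) : (y ξ, y η) ∈ x.graph := by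
  obtain ⟨z, rfl, rfl⟩ := (LinearPMap.mem_graph_iff _).1 h
  obtain ⟨h1, h2⟩ := hx y hy z
  rw [← h2]
  exact x.mem_graph ⟨_, h1⟩

/-- For y in the commutant, y and y* preserve the graph of x. So y applied to the weak solution for
h is the weak solution for y h; now use the double commutant. -/
theorem modulusResolvent_mem {x : H →ₗ.[ℂ] H} (hx : x.IsClosed) (ha : Affiliated M x) :
    modulusResolvent x ∈ M := by
  rw [← M.commutant_commutant, VonNeumannAlgebra.mem_commutant_iff]
  intro y hy
  ext h
  obtain ⟨h1, h2⟩ := modulusResolvent_spec hx h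
  refine eq_modulusResolvent hx (ha.mem_graph hy (x.mem_graph ⟨_, h1⟩)) fun ξ η hξ => ?_
  have h3 := ha.mem_graph (star_mem hy) hξ
  obtain ⟨z, hz1, hz2⟩ := (LinearPMap.mem_graph_iff _).1 h3
  have h4 := h2 z
  simp only at hz1 hz2
  rw [hz1, hz2, ContinuousLinearMap.star_eq_adjoint, ContinuousLinearMap.adjoint_inner_right,
    ContinuousLinearMap.adjoint_inner_right, ContinuousLinearMap.adjoint_inner_right] at h4
  exact h4

/-- The strong operations always extend the algebraic ones: `LinearPMap.closure` returns the
operator itself if it is not closable. -/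
theorem mem_graph_strongAdd {x y : H →ₗ.[ℂ] H} {ξ η ζ : H} (hx : (ξ, η) ∈ x.graph)
    (hy : (ξ, ζ) ∈ y.graph) : (ξ, η + ζ) ∈ (strongAdd x y).graph := by
  refine LinearPMap.le_graph_of_le (LinearPMap.le_closure _) ?_
  obtain ⟨a, ha, rfl⟩ := (LinearPMap.mem_graph_iff _).1 hx
  obtain ⟨b, hb, rfl⟩ := (LinearPMap.mem_graph_iff _).1 hy
  simp only at ha hb
  subst ha
  obtain ⟨b, hb'⟩ := b
  obtain rfl : b = a := hb
  exact (x + y).mem_graph ⟨a, a.2, hb'⟩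

theorem mem_graph_strongSMul {x : H →ₗ.[ℂ] H} {ξ η : H} (c : ℂ) (hx : (ξ, η) ∈ x.graph) :
    (ξ, c • η) ∈ (strongSMul c x).graph := by
  refine LinearPMap.le_graph_of_le (LinearPMap.le_closure _) ?_
  obtain ⟨a, rfl, rfl⟩ := (LinearPMap.mem_graph_iff _).1 hx
  exact (c • x).mem_graph a

theorem mem_graph_strongMul {x y : H →ₗ.[ℂ] H} {ξ η ζ : H} (hy : (ξ, η) ∈ y.graph)
    (hx : (η, ζ) ∈ x.graph) : (ξ, ζ) ∈ (strongMul x y).graph := by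
  refine LinearPMap.le_graph_of_le (LinearPMap.le_closure _) ?_
  obtain ⟨a, rfl, ha⟩ := (LinearPMap.mem_graph_iff _).1 hy
  obtain ⟨b, hb, rfl⟩ := (LinearPMap.mem_graph_iff _).1 hx
  simp only at ha hb
  subst ha
  obtain ⟨b, hb'⟩ := b
  obtain rfl : b = y a := hb
  have h1 : (a : H) ∈ (algMul x y).domain :=
    ⟨⟨a, hb', rfl⟩, a.2⟩
  exact (algMul x y).mem_graph ⟨a, h1⟩

theorem mem_graph_ofBounded (u : H →L[ℂ] H) (ξ : H) : (ξ, u ξ) ∈ (ofBounded u).graph :=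
  (ofBounded u).mem_graph ⟨ξ, trivial⟩

/-- An injective self-adjoint element of `M`. -/
structure IsRegularizer (M : VonNeumannAlgebra H) (g : H →L[ℂ] H) : Prop where
  mem : g ∈ M
  isSelfAdjoint : IsSelfAdjoint g
  injective : Function.Injective g

theorem mem_commutant_of_commutative (hM : ∀ a ∈ M, ∀ b ∈ M, a * b = b * a) {a : H →L[ℂ] H}
    (ha : a ∈ M) : a ∈ M.commutant :=
  VonNeumannAlgebra.mem_commutant_iff.2 fun b hb => hM b hb a ha

theorem TauMeasurable.exists_regularizer {τ : FNSTrace M} {x : H →ₗ.[ℂ] H}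
    (hx : TauMeasurable τ x) :
    ∃ g, IsRegularizer M g ∧ ∀ ξ, ∃ η, (g ξ, η) ∈ x.graph :=
  ⟨modulusResolvent x, ⟨modulusResolvent_mem hx.isClosed hx.affiliated,
    isSelfAdjoint_modulusResolvent hx.isClosed,
    injective_modulusResolvent hx.isClosed hx.dense_domain⟩, fun ξ =>
    ⟨_, x.mem_graph ⟨_, (modulusResolvent_spec hx.isClosed ξ).1⟩⟩⟩

theorem TauMeasurable.exists_regularizer₂ (hM : ∀ a ∈ M, ∀ b ∈ M, a * b = b * a)
    {τ : FNSTrace M} {x y : H →ₗ.[ℂ] H} (hx : TauMeasurable τ x) (hy : TauMeasurable τ y) :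
    ∃ g, IsRegularizer M g ∧ ∀ ξ, ∃ η ζ, (g ξ, η) ∈ x.graph ∧ (g ξ, ζ) ∈ y.graph := by
  obtain ⟨g, hg, hgx⟩ := hx.exists_regularizer
  obtain ⟨k, hk, hky⟩ := hy.exists_regularizer
  refine ⟨g * k, ⟨mul_mem hg.mem hk.mem, ?_, hg.injective.comp hk.injective⟩, fun ξ => ?_⟩
  · exact (hg.isSelfAdjoint.commute_iff hk.isSelfAdjoint).1 (hM g hg.mem k hk.mem)
  -- The range of g lies in D(x); k ξ lies in D(y), which g preserves because g is also in the
  -- commutant.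
  · obtain ⟨η, hη⟩ := hgx (k ξ)
    obtain ⟨ζ, hζ⟩ := hky ξ
    exact ⟨η, g ζ, hη, hy.affiliated.mem_graph (mem_commutant_of_commutative hM hg.mem) hζ⟩

/-- By commutativity g is in the commutant, so g ⊕ g preserves both graphs and each graph is the
closure of its image. Identities between closures thus reduce to pointwise ones on the range of g.
-/
theorem TauMeasurable.eq_of_regularizer (hM : ∀ a ∈ M, ∀ b ∈ M, a * b = b * a) {τ : FNSTrace M}
    {x y : H →ₗ.[ℂ] H} (hx : TauMeasurable τ x) (hy : TauMeasurable τ y) {g : H →L[ℂ] H}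
    (hg : IsRegularizer M g) (h : ∀ ξ, ∃ η, (g ξ, η) ∈ x.graph ∧ (g ξ, η) ∈ y.graph) : x = y := by
  have hg' := mem_commutant_of_commutative hM hg.mem
  have key {x y : H →ₗ.[ℂ] H} (hx : TauMeasurable τ x) (hy : TauMeasurable τ y)
      (h : ∀ ξ, ∃ η, (g ξ, η) ∈ x.graph ∧ (g ξ, η) ∈ y.graph) : x ≤ y := by
    refine le_of_graph_map_le hx.isClosed hy.isClosed hg.isSelfAdjoint hg.injective
      (fun ξ η hξ => hx.affiliated.mem_graph hg' hξ) fun ξ η hξ => ?_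
    obtain ⟨ζ, h1, h2⟩ := h ξ
    rwa [x.mem_graph_snd_inj (hx.affiliated.mem_graph hg' hξ) h1 rfl]
  exact le_antisymm (key hx hy h) (key hy hx fun ξ => (h ξ).imp fun η hη => hη.symm)

end Operators

/-! ### Bimodules of measurable operators as modules over a commutative M. -/

section Bimodule

variable {H : Type u} [NormedAddCommGroup H] [InnerProductSpace ℂ H] [CompleteSpace H]
  {M : VonNeumannAlgebra H} {τ : FNSTrace M} {E : Set (H →ₗ.[ℂ] H)}
  [NormedAddCommGroup E] [NormedSpace ℂ E] [CompleteSpace E]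

/-- The left action of `M` on a Banach bimodule of measurable operators. -/
def IsBanachBimodule.act (hE : IsBanachBimodule τ E) (u : M.toStarSubalgebra) (x : E) : E :=
  ⟨_, (hE.exists_mul u u.2 1 (one_mem M) x).choose⟩

namespace IsBanachBimodule

theorem norm_act_le (hE : IsBanachBimodule τ E) (u : M.toStarSubalgebra) (x : E) :
    ‖hE.act u x‖ ≤ ‖(u : H →L[ℂ] H)‖ * ‖x‖ := by
  refine (hE.exists_mul u u.2 1 (one_mem M) x).choose_spec.trans ?_
  gcongr
  exact mul_le_of_le_one_right (norm_nonneg _) ContinuousLinearMap.norm_id_le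

theorem mem_graph_act (hE : IsBanachBimodule τ E) (u : M.toStarSubalgebra) {x : E} {ξ η : H}
    (h : (ξ, η) ∈ (x : H →ₗ.[ℂ] H).graph) :
    (ξ, (u : H →L[ℂ] H) η) ∈ (hE.act u x : H →ₗ.[ℂ] H).graph :=
  mem_graph_strongMul (mem_graph_ofBounded 1 ξ) (mem_graph_strongMul h (mem_graph_ofBounded _ η))

theorem mem_graph_add (hE : IsBanachBimodule τ E) {x y : E} {ξ η ζ : H}
    (hx : (ξ, η) ∈ (x : H →ₗ.[ℂ] H).graph) (hy : (ξ, ζ) ∈ (y : H →ₗ.[ℂ] H).graph) :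
    (ξ, η + ζ) ∈ ((x + y : E) : H →ₗ.[ℂ] H).graph := by
  rw [hE.coe_add]
  exact mem_graph_strongAdd hx hy

theorem mem_graph_smul (hE : IsBanachBimodule τ E) (c : ℂ) {x : E} {ξ η : H}
    (hx : (ξ, η) ∈ (x : H →ₗ.[ℂ] H).graph) : (ξ, c • η) ∈ ((c • x : E) : H →ₗ.[ℂ] H).graph := by
  rw [hE.coe_smul]
  exact mem_graph_strongSMul c hx

variable (hM : ∀ a ∈ M, ∀ b ∈ M, a * b = b * a)
include hM

theorem eq_of_regularizer (hE : IsBanachBimodule τ E) {x y : E} {g : H →L[ℂ] H}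
    (hg : IsRegularizer M g)
    (h : ∀ ξ, ∃ η, (g ξ, η) ∈ (x : H →ₗ.[ℂ] H).graph ∧ (g ξ, η) ∈ (y : H →ₗ.[ℂ] H).graph) :
    x = y :=
  Subtype.ext <| (hE.tauMeasurable x x.2).eq_of_regularizer hM (hE.tauMeasurable y y.2) hg h

theorem act_add (hE : IsBanachBimodule τ E) (u : M.toStarSubalgebra) (x y : E) :
    hE.act u (x + y) = hE.act u x + hE.act u y := by
  obtain ⟨g, hg, h⟩ :=
    (hE.tauMeasurable x x.2).exists_regularizer₂ hM (hE.tauMeasurable y y.2)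
  refine hE.eq_of_regularizer hM hg fun ξ => ?_
  obtain ⟨η, ζ, hx, hy⟩ := h ξ
  refine ⟨_, hE.mem_graph_act u (hE.mem_graph_add hx hy), ?_⟩
  rw [map_add]
  exact hE.mem_graph_add (hE.mem_graph_act u hx) (hE.mem_graph_act u hy)

theorem add_act (hE : IsBanachBimodule τ E) (u v : M.toStarSubalgebra) (x : E) :
    hE.act (u + v) x = hE.act u x + hE.act v x := by
  obtain ⟨g, hg, h⟩ := (hE.tauMeasurable x x.2).exists_regularizer
  refine hE.eq_of_regularizer hM hg fun ξ => ?_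
  obtain ⟨η, hx⟩ := h ξ
  exact ⟨_, hE.mem_graph_act _ hx, hE.mem_graph_add (hE.mem_graph_act u hx) (hE.mem_graph_act v hx)⟩

theorem mul_act (hE : IsBanachBimodule τ E) (u v : M.toStarSubalgebra) (x : E) :
    hE.act (u * v) x = hE.act u (hE.act v x) := by
  obtain ⟨g, hg, h⟩ := (hE.tauMeasurable x x.2).exists_regularizer
  refine hE.eq_of_regularizer hM hg fun ξ => ?_
  obtain ⟨η, hx⟩ := h ξ
  exact ⟨_, hE.mem_graph_act _ hx, hE.mem_graph_act u (hE.mem_graph_act v hx)⟩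

theorem smul_one_act (hE : IsBanachBimodule τ E) (c : ℂ) (x : E) :
    hE.act (c • 1) x = c • x := by
  obtain ⟨g, hg, h⟩ := (hE.tauMeasurable x x.2).exists_regularizer
  refine hE.eq_of_regularizer hM hg fun ξ => ?_
  obtain ⟨η, hx⟩ := h ξ
  exact ⟨_, hE.mem_graph_act _ hx, hE.mem_graph_smul c hx⟩

theorem derivation_mul (hE : IsBanachBimodule τ E) {δ : M.toStarSubalgebra →ₗ[ℂ] E}
    (hδ : IsDerivation δ) (a b : M.toStarSubalgebra) :
    δ (a * b) = hE.act a (δ b) + hE.act b (δ a) := by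
  have ha := hE.tauMeasurable _ (δ a).2
  obtain ⟨g, hg, h⟩ := ha.exists_regularizer₂ hM (hE.tauMeasurable _ (δ b).2)
  refine hE.eq_of_regularizer hM hg fun ξ => ?_
  obtain ⟨η, ζ, hx, hy⟩ := h ξ
  refine ⟨_, ?_, hE.mem_graph_add (hE.mem_graph_act a hy) (hE.mem_graph_act b hx)⟩
  rw [hδ a b, add_comm]
  -- Since b also lies in the commutant, δ(a) b acts on the range of g as b δ(a): the right action
  -- agrees with the left one.
  exact mem_graph_strongAdd
    (mem_graph_strongMul (mem_graph_ofBounded _ _)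
      (ha.affiliated.mem_graph (mem_commutant_of_commutative hM b.2) hx))
    (mem_graph_strongMul hy (mem_graph_ofBounded _ _))

theorem derivation_eq_zero (hE : IsBanachBimodule τ E) {δ : M.toStarSubalgebra →ₗ[ℂ] E}
    (hδ : IsDerivation δ) (a : M.toStarSubalgebra) : δ a = 0 := by
  have ha : IsStarNormal (a : H →L[ℂ] H) := ⟨hM _ (star_mem a.2) _ a.2⟩
  let Φ : C(spectrum ℂ (a : H →L[ℂ] H), ℂ) →⋆ₐ[ℂ] M.toStarSubalgebra :=
    (cfcHom ha).codRestrict M.toStarSubalgebra fun f => by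
      change cfcHom ha f ∈ M
      -- The functional calculus of a commutes with whatever commutes with a and a*, so it stays in
      -- the double commutant.
      refine M.commutant_commutant.le (VonNeumannAlgebra.mem_commutant_iff.2 fun y hy => ?_)
      have hy' (b : H →L[ℂ] H) (hb : b ∈ M) : Commute b y :=
        VonNeumannAlgebra.mem_commutant_iff.1 hy b hb
      exact ((hy' a a.2).cfcHom ha (hy' _ (star_mem a.2)) f).symm
  have hΦ : Φ ((ContinuousMap.id ℂ).restrict _) = a := Subtype.ext (cfcHom_id ha)
  have hn (f) : ‖(Φ f : H →L[ℂ] H)‖ ≤ ‖f‖ := NonUnitalStarAlgHom.norm_apply_le (cfcHom ha) f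
  rw [← hΦ]
  exact eq_zero_of_action (fun f => hE.act (Φ f)) (fun f => hE.act_add hM (Φ f))
    (fun f g x => by rw [map_add, hE.add_act hM]) (fun f g x => by rw [map_mul, hE.mul_act hM])
    (fun c x => by rw [map_smul, map_one, hE.smul_one_act hM])
    (fun f x => (hE.norm_act_le _ _).trans (by gcongr; exact hn f))
    (δ ∘ₗ Φ.toLinearMap) (fun f g => by
      change δ (Φ (f * g)) = _
      rw [map_mul]
      exact hE.derivation_mul hM hδ _ _) _

end IsBanachBimodule

end Bimodule

/-! ### Function bimodules on (0,1). -/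

section FunctionBimodule

theorem S01_mul_add (a b c : S01) : a * (b + c) = a * b + a * c :=
  AEEqFun.toGerm_injective <| by
    simp only [AEEqFun.mul_toGerm, AEEqFun.add_toGerm, mul_add]

theorem S01_add_mul (a b c : S01) : (a + b) * c = a * c + b * c := by
  rw [mul_comm, S01_mul_add, mul_comm c, mul_comm c]

theorem S01_smul_mul (z : ℂ) (a b : S01) : (z • a) * b = z • (a * b) :=
  AEEqFun.induction_on₂ a b fun f hf g hg => by
    simp only [AEEqFun.smul_mk, AEEqFun.mk_mul_mk, smul_mul_assoc]

/-- Provides the compact space: the closed ball of radius ‖f‖ replaces the spectrum, and φ ↦ φ ∘ q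
replaces the functional calculus, sending the identity to f. -/
theorem exists_measurable_closedBall_ae_eq (f : Linf01) :
    ∃ q : ℝ → Metric.closedBall (0 : ℂ) ‖f‖, Measurable q ∧ f =ᵐ[unitMeasure] fun t => (q t : ℂ) := by
  have hm : MeasurableSet {t | f t ∈ Metric.closedBall (0 : ℂ) ‖f‖} :=
    (Lp.stronglyMeasurable f).measurable Metric.isClosed_closedBall.measurableSet
  classical
  refine ⟨fun t => ⟨if f t ∈ Metric.closedBall (0 : ℂ) ‖f‖ then f t else 0, ?_⟩, ?_, ?_⟩
  · split_ifs with h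
    exacts [h, Metric.mem_closedBall_self (norm_nonneg _)]
  · exact (Measurable.ite hm (Lp.stronglyMeasurable f).measurable measurable_const).subtype_mk
  · have h1 := ae_le_eLpNormEssSup (f := f) (μ := unitMeasure)
    filter_upwards [h1] with t ht
    have h2 : f t ∈ Metric.closedBall (0 : ℂ) ‖f‖ := by
      rw [mem_closedBall_zero_iff, Lp.norm_def, eLpNorm_exponent_top, ← toReal_enorm]
      refine ENNReal.toReal_mono ?_ ht
      rw [← eLpNorm_exponent_top]
      exact Lp.eLpNorm_ne_top f
    exact (if_pos h2).symm

variable {K : Type*} [TopologicalSpace K] [MeasurableSpace K] [OpensMeasurableSpace K]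
  [CompactSpace K]

theorem memLp_comp_continuousMap {q : ℝ → K} (hq : Measurable q) (φ : C(K, ℂ)) :
    MemLp (φ ∘ q) ∞ unitMeasure :=
  memLp_top_of_bound (φ.continuous.measurable.comp hq).aestronglyMeasurable ‖φ‖
    (ae_of_all _ fun t => φ.norm_coe_le_norm (q t))

/-- Composition of continuous functions on a compact space with a measurable map `(0,1) → K`. -/
def compLinf {q : ℝ → K} (hq : Measurable q) : C(K, ℂ) →ₗ[ℂ] Linf01 where
  toFun φ := (memLp_comp_continuousMap hq φ).toLp (φ ∘ q)
  map_add' _ _ := rfl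
  map_smul' _ _ := rfl

variable {q : ℝ → K} (hq : Measurable q)

theorem compLinf_mul (φ ψ : C(K, ℂ)) :
    (compLinf hq (φ * ψ) : S01) = (compLinf hq φ : S01) * (compLinf hq ψ : S01) :=
  rfl

theorem compLinf_one : (compLinf hq 1 : S01) = 1 :=
  rfl

theorem norm_compLinf_le (φ : C(K, ℂ)) : ‖compLinf hq φ‖ ≤ ‖φ‖ := by
  refine (Lp.norm_toLp _ (memLp_comp_continuousMap hq φ)).trans_le
    (ENNReal.toReal_le_of_le_ofReal (norm_nonneg _) ?_)
  rw [eLpNorm_exponent_top]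
  exact eLpNormEssSup_le_of_ae_bound (ae_of_all _ fun t => φ.norm_coe_le_norm (q t))

variable {E : Set S01} [NormedAddCommGroup E] [NormedSpace ℂ E] [CompleteSpace E]

theorem IsBanachFunctionBimodule.exists_mul_compLinf (hE : IsBanachFunctionBimodule E)
    (φ : C(K, ℂ)) (x : E) : ∃ h : (compLinf hq φ : S01) * (x : S01) ∈ E,
      ‖(⟨_, h⟩ : E)‖ ≤ ‖φ‖ * ‖x‖ := by
  obtain ⟨h, hn⟩ := hE.exists_mul (compLinf hq φ) (compLinf hq 1) x
  have h1 : (compLinf hq φ : S01) * (x : S01) * (compLinf hq 1 : S01) =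
      (compLinf hq φ : S01) * (x : S01) := by rw [compLinf_one, mul_one]
  simp only [h1] at h hn
  refine ⟨h, hn.trans ?_⟩
  gcongr
  refine mul_le_of_le_one_right (norm_nonneg _) ?_ |>.trans (norm_compLinf_le hq φ)
  exact (norm_compLinf_le hq 1).trans ((ContinuousMap.norm_le _ zero_le_one).2 fun _ => by simp)

theorem IsBanachFunctionBimodule.derivation_eq_zero (hE : IsBanachFunctionBimodule E)
    {δ : Linf01 →ₗ[ℂ] S01} (hδ : IsFunctionDerivation δ) (hδE : ∀ f, δ f ∈ E) (f : Linf01) :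
    δ f = 0 := by
  obtain ⟨q, hq, hf⟩ := exists_measurable_closedBall_ae_eq f
  have : CompactSpace (Metric.closedBall (0 : ℂ) ‖f‖) :=
    isCompact_iff_compactSpace.1 (isCompact_closedBall _ _)
  have hq' : compLinf hq ((ContinuousMap.id ℂ).restrict _) =ᵐ[unitMeasure] fun t => (q t : ℂ) :=
    (memLp_comp_continuousMap hq _).coeFn_toLp
  have hfq : f = compLinf hq ((ContinuousMap.id ℂ).restrict _) := Lp.ext (hf.trans hq'.symm)
  choose h hn using hE.exists_mul_compLinf hq
  have h0 : ((0 : E) : S01) = 0 := by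
    have h1 := hE.coe_smul 0 0
    rw [zero_smul] at h1
    exact h1.trans (zero_smul ℂ ((0 : E) : S01))
  let d : C(Metric.closedBall (0 : ℂ) ‖f‖, ℂ) →ₗ[ℂ] E :=
    { toFun φ := ⟨δ (compLinf hq φ), hδE _⟩
      map_add' φ ψ := Subtype.ext <| by
        rw [hE.coe_add]; simp only [map_add]
      map_smul' c φ := Subtype.ext <| by
        rw [hE.coe_smul]; simp only [map_smul, RingHom.id_apply] }
  have key := eq_zero_of_action (fun φ x => (⟨_, h φ x⟩ : E))
    (fun φ x y => Subtype.ext <| by simp only [hE.coe_add, S01_mul_add])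
    (fun φ ψ x => Subtype.ext <| by
      simp only [hE.coe_add, map_add, AddSubgroup.coe_add, S01_add_mul])
    (fun φ ψ x => Subtype.ext <| by simp only [compLinf_mul, mul_assoc])
    (fun c x => Subtype.ext <| by
      simp only [hE.coe_smul, map_smul]
      change (c • (compLinf hq 1 : S01)) * (x : S01) = _
      rw [compLinf_one, S01_smul_mul, one_mul])
    hn d (fun φ ψ => Subtype.ext <| by
      rw [hE.coe_add]
      change δ (linfMul (compLinf hq φ) (compLinf hq ψ)) = _
      rw [hδ, add_comm, mul_comm (δ _)]
      rfl)
    ((ContinuousMap.id ℂ).restrict _)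
  rw [hfq]
  exact (congrArg Subtype.val key).trans h0

end FunctionBimodule

end TauCompact

end

theorem corollary3p8 :
    (∀ {H : Type*} [NormedAddCommGroup H] [InnerProductSpace ℂ H] [CompleteSpace H]
      (M : VonNeumannAlgebra H) (τ : TauCompact.FNSTrace M),
      (∀ a ∈ M, ∀ b ∈ M, a * b = b * a) →
      ∀ (E : Set (H →ₗ.[ℂ] H)) [NormedAddCommGroup E] [NormedSpace ℂ E] [CompleteSpace E],
        TauCompact.IsBanachBimodule τ E → (∀ x ∈ E, TauCompact.TauCompactOp τ x) →
        ∀ δ : M.toStarSubalgebra →ₗ[ℂ] E, TauCompact.IsDerivation δ → ∀ a, δ a = 0) ∧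
    (∀ (E : Set TauCompact.S01) [NormedAddCommGroup E] [NormedSpace ℂ E] [CompleteSpace E],
      TauCompact.IsBanachFunctionBimodule E →
      ∀ δ : TauCompact.Linf01 →ₗ[ℂ] TauCompact.S01, TauCompact.IsFunctionDerivation δ →
        (∀ f, δ f ∈ E) → ∀ f, δ f = 0) :=
  ⟨fun _ _ hM _ _ _ _ hE _ _ hδ a => hE.derivation_eq_zero hM hδ a,
    fun _ _ _ _ hE _ hδ hδE f => hE.derivation_eq_zero hδ hδE f⟩
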